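/- Let $p$ be a prime number and let $k$ be a field of characteristic $p$ that is $F$-finite, i.e. whose Frobenius map is finite. Let $A = k[x_1,\dots,x_d]$ be graded by $\deg x_i = a_i$ with positive integers $a_1,\dots,a_d$, let $\mathfrak m = (x_1,\dots,x_d)$, and let $f \in \mathfrak m$ be a (weighted) homogeneous polynomial of degree $D > 0$. For a proper non-zero ideal $\mathfrak b$ of $R = A_{\mathfrak m}$, let $\mathrm{fpt}(R;\mathfrak b)$ be the supremum of all real $s \ge 0$ such that $(R,\mathfrak b^s)$ is sharply $F$-pure, i.e. such that $\varphi\bigl(F^e_*\,\mathfrak b^{\lceil s(p^e-1)\rceil}\bigr) = R$ for some integer $e > 0$ and some $\varphi \in \mathrm{Hom}_R(F^e_*R, R)$; set $\mathrm{fpt}(R;0) = 0$. Let $\mathrm{FPT}^{\mathrm{pr}}(R) \subseteq \mathbb R$ be the set of all $\mathrm{fpt}(R;\mathfrak b)$ with $\mathfrak b \subsetneq R$ a principal ideal. Assume that $$\text{(a)}\quad \mathrm{fpt}(A_{\mathfrak m};(f)) < \frac{a_1+\dots+a_d}{D}, \qquad \text{(b)}\quad \mathrm{fpt}(A_{\mathfrak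 m};(f)) \notin \mathbb Z[1/p].$$ Then $\mathrm{fpt}(A_{\mathfrak m};(f))$ is an accumulation point of $\mathrm{FPT}^{\mathrm{pr}}(A_{\mathfrak m})$. Moreover, there is a sequence of monomials $\alpha_n = x_1^{\lambda_{n,1}}\cdots x_d^{\lambda_{n,d}}$ with $\deg \alpha_n \to \infty$ such that $\mathrm{fpt}(A_{\mathfrak m};(f+\alpha_n)) > \mathrm{fpt}(A_{\mathfrak m};(f))$ for all $n$ and $\lim_{n\to\infty} \mathrm{fpt}(A_{\mathfrak m};(f+\alpha_n)) = \mathrm{fpt}(A_{\mathfrak m};(f))$. -/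

import Mathlib

open MvPolynomial Filter Topology

noncomputable section

namespace FPT

/-- A ring `R` of characteristic `p` is `F`-finite if its Frobenius map is a finite ring
homomorphism. -/
def IsFFinite (p : ℕ) (R : Type*) [CommRing R] [ExpChar R p] : Prop :=
  (frobenius R p).Finite

/-- The elements of `Hom_R(F^e_* R, R)`: the additive maps `φ : R → R` such that
`φ (r ^ (p ^ e) * x) = r * φ x` for all `r` and `x`. -/
def IsCartierMap (p : ℕ) {R : Type*} [CommRing R] (e : ℕ) (φ : R →+ R) : Prop :=
  ∀ r x : R, φ (r ^ p ^ e * x) = r * φ x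

/-- The pair `(R, I ^ s)`, with zero boundary divisor, is sharply `F`-pure: for some `e > 0`
and some `φ ∈ Hom_R(F^e_* R, R)` the image of `F^e_* (I ^ ⌈s (p ^ e - 1)⌉)` under `φ` is all
of `R`. -/
def IsSharplyFPure (p : ℕ) {R : Type*} [CommRing R] (I : Ideal R) (s : ℝ) : Prop :=
  ∃ e : ℕ, 0 < e ∧ ∃ φ : R →+ R, IsCartierMap p e φ ∧
    φ '' ((I ^ ⌈s * ((p : ℝ) ^ e - 1)⌉₊ : Ideal R) : Set R) = Set.univ

open Classical in
/-- The `F`-pure threshold `fpt(R; I)` of a proper ideal `I` of a local ring `R` of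
characteristic `p`; it is `0` by convention for the zero ideal. -/
def fpt (p : ℕ) {R : Type*} [CommRing R] (I : Ideal R) : ℝ :=
  if I = ⊥ then 0 else sSup {s : ℝ | 0 ≤ s ∧ IsSharplyFPure p I s}

/-- The set `FPT^pr(R)` of the `F`-pure thresholds of all proper principal ideals of `R`. -/
def principalThresholds (p : ℕ) (R : Type*) [CommRing R] : Set ℝ :=
  {t : ℝ | ∃ I : Ideal R, I ≠ ⊤ ∧ I.IsPrincipal ∧ t = fpt p I}

theorem idealOfVars_eq_ker (k : Type*) [Field k] (d : ℕ) :
    idealOfVars (Fin d) k = RingHom.ker (constantCoeff : MvPolynomial (Fin d) k →+* k) := by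
  ext f
  rw [idealOfVars, ← Set.image_univ, mem_ideal_span_X_image, RingHom.mem_ker,
    constantCoeff_eq]
  constructor
  · intro h
    by_contra h0
    obtain ⟨i, -, hi⟩ := h 0 (mem_support_iff.mpr h0)
    exact hi rfl
  · intro h m hm
    by_contra! hc
    have hm0 : m = 0 := by
      ext i
      exact hc i (Set.mem_univ i)
    rw [mem_support_iff, hm0] at hm
    exact hm h

instance idealOfVars_isPrime (k : Type*) [Field k] (d : ℕ) :
    (idealOfVars (Fin d) k).IsPrime := by
  rw [idealOfVars_eq_ker]
  exact RingHom.ker_isPrime _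

/-- The local ring `A_𝔪` of `A = k[x_1, …, x_d]` at `𝔪 = (x_1, …, x_d)`. -/
abbrev OriginLocalRing (k : Type*) [Field k] (d : ℕ) : Type _ :=
  Localization.AtPrime (idealOfVars (Fin d) k)

/-- The `F`-pure threshold at the origin `fpt(A_𝔪; (f))` of a polynomial `f`. -/
def fptAtOrigin (p : ℕ) {k : Type*} [Field k] {d : ℕ} (f : MvPolynomial (Fin d) k) : ℝ :=
  fpt p (Ideal.span {algebraMap (MvPolynomial (Fin d) k) (OriginLocalRing k d) f})

end FPT

end

/-! Write `c` for the threshold of `f` and `𝔪^[q]` for the ideal of the `x_i ^ q`, with `q = p ^ e`.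
Everything rests on two estimates: `g ^ r ∈ 𝔪^[q]` forces `fpt(g) ≤ r / q` (`fptAtOrigin_le_div`),
while `g ^ r ∉ 𝔪^[q]` gives `fpt(g) ≥ r / q` for `r, e > 0` (`div_le_fptAtOrigin`). Let `N = ⌊c q⌋`.
Since `c ∉ ℤ[1/p]`, `f ^ N ∉ 𝔪^[q]`, so some monomial `x ^ μ` of `f ^ N` has all exponents below
`q`. Let `x ^ l` be its complement in `(x_1 ⋯ x_d) ^ (q - 1)`. By homogeneity `deg x ^ l = (q - 1) ∑
a_i - N D`, which is unbounded in `e` by assumption (a). In `(f + x ^ l) ^ (N + 1)` the monomial `x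
^ (μ + l)` has coefficient `N + 1` times that of `x ^ μ` in `f ^ N`. This is nonzero when `p ∤ N +
1`, which happens for arbitrarily large `e`; then `fpt(f + x ^ l) ≥ (N + 1) / q > c`. Conversely, a
monomial of high degree lies in a given `𝔪^[q]`, so adding it raises the threshold by at most `1 /
q`. -/

namespace FPT

/-! ### Threshold bounds from Cartier maps. -/

section Upper

variable {p : ℕ} {R : Type*} [CommRing R]

theorem IsCartierMap.comp {e e' : ℕ} {φ ψ : R →+ R} (hψ : IsCartierMap p e ψ)
    (hφ : IsCartierMap p e' φ) : IsCartierMap p (e + e') (ψ.comp φ) := by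
  intro r x
  simp only [AddMonoidHom.comp_apply]
  rw [pow_add, pow_mul, hφ, hψ]

theorem IsCartierMap.comp_mulLeft {e : ℕ} {φ : R →+ R} (hφ : IsCartierMap p e φ) (h : R) :
    IsCartierMap p e (φ.comp (AddMonoidHom.mulLeft h)) := by
  intro r x
  simp only [AddMonoidHom.comp_apply, AddMonoidHom.coe_mulLeft]
  rw [mul_left_comm, hφ]

/-- A `p ^ e`-linear Cartier map sends the `p ^ e`-th Frobenius power of an ideal into the
ideal. -/
theorem IsCartierMap.apply_mem [ExpChar R p] {e : ℕ} {φ : R →+ R} (hφ : IsCartierMap p e φ)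
    (𝔪 : Ideal R) {x : R} (hx : x ∈ 𝔪.map (iterateFrobenius R p e)) : φ x ∈ 𝔪 := by
  suffices ∀ y, φ (y * x) ∈ 𝔪 by simpa using this 1
  refine Submodule.span_induction (p := fun x _ => ∀ y, φ (y * x) ∈ 𝔪) ?_ ?_ ?_ ?_ hx
  · rintro _ ⟨r, hr, rfl⟩ y
    rw [iterateFrobenius_def, mul_comm, hφ]
    exact 𝔪.mul_mem_right _ hr
  · intro y
    simp
  · intro a b _ _ ha hb y
    rw [mul_add, map_add]
    exact 𝔪.add_mem (ha y) (hb y)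
  · intro a b _ hb y
    rw [smul_eq_mul, ← mul_assoc]
    exact hb _

/-- If a Cartier map sends `g ^ N` to `1`, its iterates send the powers of `g` whose exponents
are the partial sums of `N (1 + q + q ^ 2 + ⋯)` to `1`. -/
theorem IsCartierMap.exists_iterate {e N : ℕ} {φ : R →+ R} {g : R} (hφ : IsCartierMap p e φ)
    (h1 : φ (g ^ N) = 1) (hp : 1 < p) (n : ℕ) :
    ∃ t : ℕ, t * (p ^ e - 1) = N * ((p ^ e) ^ n - 1) ∧
      ∃ ψ : R →+ R, IsCartierMap p (n * e) ψ ∧ ψ (g ^ t) = 1 := by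
  induction n with
  | zero => exact ⟨0, by simp, AddMonoidHom.id R, by intro r x; simp, by simp⟩
  | succ n ih =>
    obtain ⟨t, ht, ψ, hψ, hψ1⟩ := ih
    refine ⟨N + p ^ e * t, ?_, ψ.comp φ, ?_, ?_⟩
    · have hq : 1 ≤ p ^ e := Nat.one_le_pow _ _ (by omega)
      have hQ : 1 ≤ (p ^ e) ^ n := Nat.one_le_pow _ _ hq
      have hQ' : 1 ≤ (p ^ e) ^ (n + 1) := Nat.one_le_pow _ _ hq
      zify [hq, hQ, hQ'] at ht ⊢
      rw [pow_succ]
      linear_combination ((p : ℤ) ^ e) * ht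
    · rw [Nat.succ_mul]
      exact hψ.comp hφ
    · rw [AddMonoidHom.comp_apply, pow_add, pow_mul', mul_comm, hφ, h1, mul_one, hψ1]

theorem pow_pow_mem_map_iterateFrobenius [ExpChar R p] {𝔪 : Ideal R} {x : R} {e : ℕ}
    (hx : x ∈ 𝔪.map (iterateFrobenius R p e)) (j : ℕ) :
    x ^ p ^ j ∈ 𝔪.map (iterateFrobenius R p (e + j)) := by
  have := Ideal.mem_map_of_mem (iterateFrobenius R p j) hx
  rw [Ideal.map_map, ← iterateFrobenius_add, iterateFrobenius_def] at this
  rwa [add_comm e j]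

/-- If `g ^ r` lies in the Frobenius power `𝔪 ^ [p ^ e]`, then `(R, g ^ s)` can only be sharply
`F`-pure for `s ≤ r / p ^ e`. -/
theorem IsSharplyFPure.le_div [ExpChar R p] (hp : 1 < p) {𝔪 : Ideal R} (h𝔪 : 𝔪 ≠ ⊤) {g : R}
    {r e : ℕ} (hg : g ^ r ∈ 𝔪.map (iterateFrobenius R p e)) {s : ℝ}
    (hs : IsSharplyFPure p (Ideal.span {g}) s) : s ≤ r / (p : ℝ) ^ e := by
  obtain ⟨e', he', φ, hφ, himg⟩ := hs
  set N := ⌈s * ((p : ℝ) ^ e' - 1)⌉₊ with hN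
  obtain ⟨x, hx, hx1⟩ : (1 : R) ∈ φ '' ((Ideal.span {g} ^ N : Ideal R) : Set R) := by
    rw [himg]; trivial
  rw [Ideal.span_singleton_pow, SetLike.mem_coe, Ideal.mem_span_singleton'] at hx
  obtain ⟨h, rfl⟩ := hx
  have hq : 1 < p ^ e' := Nat.one_lt_pow he'.ne' hp
  have key : N * p ^ e ≤ r * (p ^ e' - 1) := by
    by_contra! hlt
    -- The exponents `t` of the iterates satisfy `t / p ^ (n e') → N / (p ^ e' - 1) > r / p ^ e`.
    -- This `n` is large enough for the strict inequality to survive the error term, and for `e ≤ n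
    -- e'`.
    set n := e + r * p ^ e' + 1 with hn
    obtain ⟨t, ht, ψ, hψ, hψ1⟩ := (hφ.comp_mulLeft h).exists_iterate (g := g) hx1 hp n
    have hne : e ≤ n * e' := by nlinarith
    obtain ⟨j, hj⟩ := Nat.exists_eq_add_of_le hne
    have hlt2 : t < r * p ^ j := by
      by_contra! hle
      apply h𝔪
      rw [Ideal.eq_top_iff_one, ← hψ1]
      apply hψ.apply_mem
      rw [hj, ← Nat.sub_add_cancel hle, pow_add]
      apply Ideal.mul_mem_left
      rw [pow_mul]
      exact pow_pow_mem_map_iterateFrobenius hg j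
    have hQ : (p ^ e') ^ n = p ^ e * p ^ j := by rw [← pow_mul, ← pow_add, mul_comm e', hj]
    have hnQ : n < (p ^ e') ^ n := Nat.lt_pow_self hq
    have hpe : 1 ≤ p ^ e := Nat.one_le_pow _ _ (by omega)
    obtain ⟨q, hq'⟩ : ∃ q, p ^ e' = q + 1 := ⟨p ^ e' - 1, by omega⟩
    obtain ⟨Q, hQ'⟩ : ∃ Q, (p ^ e') ^ n = Q + 1 := ⟨(p ^ e') ^ n - 1, by omega⟩
    rw [hQ'] at ht hnQ hQ
    rw [hq'] at ht hlt hn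
    simp only [Nat.add_sub_cancel] at ht hlt
    have h2 : N * Q * p ^ e ≤ r * (Q + 1) * q := by
      rw [← ht, hQ]
      calc t * q * p ^ e ≤ (r * p ^ j) * q * p ^ e := by gcongr
        _ = _ := by ring
    have h3 : (r * q + 1) * Q ≤ N * p ^ e * Q := Nat.mul_le_mul_right _ hlt
    nlinarith
  have hpe : (0 : ℝ) < (p : ℝ) ^ e := by positivity
  have hq1 : (0 : ℝ) < (p : ℝ) ^ e' - 1 := by
    rw [sub_pos]; exact_mod_cast hq
  have key' : (N : ℝ) * (p : ℝ) ^ e ≤ r * ((p : ℝ) ^ e' - 1) := by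
    have : ((p ^ e' - 1 : ℕ) : ℝ) = (p : ℝ) ^ e' - 1 := by
      rw [Nat.cast_sub hq.le]; push_cast; rfl
    rw [← this]
    exact_mod_cast key
  rw [le_div_iff₀ hpe]
  have hsN : s * ((p : ℝ) ^ e' - 1) ≤ N := Nat.le_ceil _
  refine le_of_mul_le_mul_right ?_ hq1
  nlinarith

theorem fpt_span_singleton_le_div [ExpChar R p] (hp : 1 < p) {𝔪 : Ideal R} (h𝔪 : 𝔪 ≠ ⊤) {g : R}
    {r e : ℕ} (hg : g ^ r ∈ 𝔪.map (iterateFrobenius R p e)) :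
    fpt p (Ideal.span {g}) ≤ r / (p : ℝ) ^ e := by
  unfold fpt
  split_ifs
  · positivity
  · exact Real.sSup_le (fun s hs => hs.2.le_div hp h𝔪 hg) (by positivity)

theorem div_le_fpt_span_singleton [ExpChar R p] [Nontrivial R] (hp : 1 < p) {𝔪 : Ideal R}
    (h𝔪 : 𝔪 ≠ ⊤) {g : R} (hg : g ∈ 𝔪) {r e : ℕ} (hr : r ≠ 0) (he : 0 < e) {φ : R →+ R}
    (hφ : IsCartierMap p e φ) (hu : IsUnit (φ (g ^ r))) :
    r / ((p : ℝ) ^ e - 1) ≤ fpt p (Ideal.span {g}) := by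
  have hg0 : g ≠ 0 := by
    rintro rfl
    simp [zero_pow hr] at hu
  have hq1 : (0 : ℝ) < (p : ℝ) ^ e - 1 := by
    rw [sub_pos]; exact_mod_cast Nat.one_lt_pow he.ne' hp
  rw [fpt, if_neg (by simpa using hg0)]
  -- The set is bounded by `1` because `g ^ 1 ∈ 𝔪 = 𝔪^[p ^ 0]`.
  refine le_csSup ⟨1, fun s hs => ?_⟩ ⟨by positivity, e, he, φ, hφ, ?_⟩
  · simpa using hs.2.le_div (r := 1) (e := 0) hp h𝔪 (by simpa [Ideal.map_id] using hg)
  · rw [div_mul_cancel₀ _ hq1.ne', Nat.ceil_natCast, Set.eq_univ_iff_forall]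
    intro y
    obtain ⟨u, hu⟩ := hu
    refine ⟨(y * ↑u⁻¹) ^ p ^ e * g ^ r, ?_, ?_⟩
    · rw [Ideal.span_singleton_pow, SetLike.mem_coe, Ideal.mem_span_singleton']
      exact ⟨_, rfl⟩
    · rw [hφ, ← hu, mul_assoc, Units.inv_mul, mul_one]

end Upper

/-! ### Construction of Cartier maps on fields, polynomial rings and localizations. -/

section CartierMaps

variable (p : ℕ)

/-- Over the subfield of `p ^ e`-th powers, some linear functional takes the value `1` at `c`;
follow it by the inverse of Frobenius onto its image. -/
theorem exists_isCartierMap_apply_eq_one {k : Type*} [Field k] [ExpChar k p] (e : ℕ) {c : k}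
    (hc : c ≠ 0) : ∃ ψ : k →+ k, IsCartierMap p e ψ ∧ ψ c = 1 := by
  let F := iterateFrobenius k p e
  let K : Subfield k := F.fieldRange
  obtain ⟨g, hg⟩ : ∃ g : Module.Dual K k, g c ≠ 0 := by
    by_contra! h
    exact hc ((Module.forall_dual_apply_eq_zero_iff K c).mp h)
  let E : k ≃+* K := RingEquiv.ofBijective F.rangeRestrictField F.rangeRestrictField_bijective
  refine ⟨(E.symm : K ≃+ k).toAddMonoidHom.comp ((g c)⁻¹ • g).toAddMonoidHom, ?_, ?_⟩
  · intro r x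
    have h1 : r ^ p ^ e * x = E r • x := rfl
    rw [h1]
    have h2 : ((g c)⁻¹ • g) (E r • x) = E r * ((g c)⁻¹ • g) x := by
      rw [map_smul, smul_eq_mul]
    change E.symm (((g c)⁻¹ • g) (E r • x)) = r * E.symm (((g c)⁻¹ • g) x)
    rw [h2, map_mul, RingEquiv.symm_apply_apply]
  · change E.symm (((g c)⁻¹ • g) c) = 1
    rw [LinearMap.smul_apply, smul_eq_mul, inv_mul_cancel₀ hg, map_one]

/-- A Cartier map of the coefficients extends to polynomials, selecting the monomials
`μ + p ^ e n` with `μ` a fixed exponent vector with entries less than `p ^ e`. -/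
theorem IsCartierMap.exists_mvPolynomial {p} {k σ : Type*} [CommRing k] [ExpChar k p] {e : ℕ}
    {ψ : k →+ k} (hψ : IsCartierMap p e ψ) (hp : p ≠ 0) {μ : σ →₀ ℕ} (hμ : ∀ i, μ i < p ^ e) :
    ∃ φ : MvPolynomial σ k →+ MvPolynomial σ k, IsCartierMap p e φ ∧
      ∀ f n, coeff n (φ f) = ψ (coeff (μ + p ^ e • n) f) := by
  have hq : p ^ e ≠ 0 := pow_ne_zero _ hp
  have hinj : Function.Injective (fun n : σ →₀ ℕ => μ + p ^ e • n) := by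
    intro n m h
    ext i
    have := DFunLike.congr_fun h i
    simp only [Finsupp.coe_add, Finsupp.coe_smul, Pi.add_apply, Pi.smul_apply, smul_eq_mul,
      add_right_inj] at this
    exact Nat.eq_of_mul_eq_mul_left (Nat.pos_of_ne_zero hq) this
  let φ₀ : MvPolynomial σ k → MvPolynomial σ k := fun f => AddMonoidAlgebra.ofCoeff
    (((AddMonoidAlgebra.coeff f).comapDomain _ hinj.injOn).mapRange ψ (map_zero ψ))
  have hφ₀ : ∀ f n, coeff n (φ₀ f) = ψ (coeff (μ + p ^ e • n) f) := fun f n => rfl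
  let φ : MvPolynomial σ k →+ MvPolynomial σ k :=
    { toFun := φ₀
      map_zero' := by ext n; rw [hφ₀]; simp
      map_add' := fun f g => by ext n; rw [coeff_add]; simp only [hφ₀]; rw [coeff_add, map_add] }
  have hφ : ∀ f n, coeff n (φ f) = ψ (coeff (μ + p ^ e • n) f) := hφ₀
  refine ⟨φ, ?_, hφ⟩
  intro r x
  induction r using MvPolynomial.induction_on' with
  | monomial m c =>
    ext n
    rw [hφ, monomial_pow, coeff_monomial_mul', coeff_monomial_mul', hφ]
    have hle : p ^ e • m ≤ μ + p ^ e • n ↔ m ≤ n := by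
      refine ⟨fun h i => ?_, fun h => ?_⟩
      · have := h i
        simp only [Finsupp.coe_smul, Finsupp.coe_add, Pi.smul_apply, Pi.add_apply,
          smul_eq_mul] at this
        have h3 := hμ i
        by_contra! hlt
        nlinarith
      · exact (nsmul_le_nsmul_right h _).trans le_add_self
    by_cases h : m ≤ n
    · rw [if_pos (hle.mpr h), if_pos h, hψ]
      congr 3
      obtain ⟨l, rfl⟩ := exists_add_of_le h
      rw [add_tsub_cancel_left, smul_add, add_left_comm, add_tsub_cancel_left]
    · rw [if_neg (mt hle.mp h), if_neg h, map_zero]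
  | add a b ha hb =>
    have : (a + b) ^ p ^ e = a ^ p ^ e + b ^ p ^ e := add_pow_expChar_pow ..
    rw [this, add_mul, map_add, ha, hb, add_mul]

/-- A Cartier map of a domain extends to its localizations. -/
theorem IsCartierMap.exists_localization {p} {A B : Type*} [CommRing A] [IsDomain A] [CommRing B]
    [Algebra A B] {M : Submonoid A} [IsLocalization M B] (hM : M ≤ nonZeroDivisors A) {e : ℕ}
    (hp : p ≠ 0) {φ : A →+ A} (hφ : IsCartierMap p e φ) :
    ∃ φ' : B →+ B, IsCartierMap p e φ' ∧ ∀ a, φ' (algebraMap A B a) = algebraMap A B (φ a) := by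
  obtain ⟨q, hq⟩ : ∃ q, p ^ e = q + 1 := Nat.exists_eq_succ_of_ne_zero (pow_ne_zero _ hp)
  have hinj : Function.Injective (algebraMap A B) := IsLocalization.injective B hM
  have hφ' : ∀ r x : A, φ (x * r ^ q * r) = φ x * r := fun r x => by
    rw [mul_assoc, ← pow_succ, ← hq, mul_comm, hφ, mul_comm]
  -- Since `a / s = a s ^ q / s ^ (p ^ e)` with `q = p ^ e - 1`, the extension must send it to `φ (a
  -- s ^ q) / s`; `hf` shows that the chosen fraction does not matter.
  let f : B → B := fun b => IsLocalization.mk' B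
    (φ ((IsLocalization.sec M b).1 * (IsLocalization.sec M b).2 ^ q)) (IsLocalization.sec M b).2
  have hunit : ∀ s : M, ∀ x y : B, x * algebraMap A B s = y * algebraMap A B s → x = y :=
    fun s x y h => (IsLocalization.map_units B s).mul_right_cancel h
  have hf : ∀ b : B, ∀ a : A, ∀ s : M, b * algebraMap A B s = algebraMap A B a →
      f b * algebraMap A B s = algebraMap A B (φ (a * (s : A) ^ q)) := by
    intro b a s h
    have hsec := IsLocalization.sec_spec M b
    set a' := (IsLocalization.sec M b).1
    set s' := (IsLocalization.sec M b).2
    have h' : a * s' = a' * s := by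
      apply hinj
      rw [map_mul, map_mul, ← h, ← hsec]
      ring
    apply hunit s'
    have h2 : f b * algebraMap A B s' = algebraMap A B (φ (a' * (s' : A) ^ q)) :=
      IsLocalization.mk'_spec ..
    rw [mul_right_comm, h2, ← map_mul, ← map_mul, ← hφ', ← hφ']
    congr 2
    linear_combination (-(s' : A) ^ q * (s : A) ^ q) * h'
  have hadd : ∀ x y, f (x + y) = f x + f y := by
    intro x y
    obtain ⟨⟨a, s⟩, ha⟩ := IsLocalization.surj M x
    obtain ⟨⟨b, t⟩, hb⟩ := IsLocalization.surj M y
    dsimp only at ha hb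
    have hx := hf x (a * t) (s * t) (by rw [Submonoid.coe_mul, map_mul, map_mul, ← ha]; ring)
    have hy := hf y (b * s) (s * t) (by rw [Submonoid.coe_mul, map_mul, map_mul, ← hb]; ring)
    have hxy := hf (x + y) (a * t + b * s) (s * t)
      (by rw [Submonoid.coe_mul, map_add, map_mul, map_mul, map_mul, ← ha, ← hb]; ring)
    apply hunit (s * t)
    rw [hxy, add_mul (f x), hx, hy, ← map_add, ← map_add, ← add_mul]
  refine ⟨AddMonoidHom.mk' f hadd, ?_, ?_⟩
  · intro r x
    simp only [AddMonoidHom.mk'_apply]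
    obtain ⟨⟨a, s⟩, ha⟩ := IsLocalization.surj M r
    obtain ⟨⟨b, t⟩, hb⟩ := IsLocalization.surj M x
    dsimp only at ha hb
    have hx := hf x b t hb
    have hrx := hf (r ^ p ^ e * x) (a ^ p ^ e * b) (s ^ p ^ e * t) (by
      rw [Submonoid.coe_mul, SubmonoidClass.coe_pow, map_mul, map_mul, map_pow, map_pow, ← ha, ← hb]; ring)
    apply hunit (s ^ p ^ e * t)
    rw [hrx]
    have hsp : algebraMap A B ((s ^ p ^ e * t : M) : A) =
        algebraMap A B s * algebraMap A B t * algebraMap A B ((s : A) ^ q) := by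
      rw [Submonoid.coe_mul, SubmonoidClass.coe_pow, hq, map_mul, map_pow, map_pow]; ring
    calc _ = algebraMap A B (φ ((a * (s : A) ^ q) ^ p ^ e * (b * (t : A) ^ q))) := by
          congr 2; rw [Submonoid.coe_mul, SubmonoidClass.coe_pow]; ring
      _ = r * f x * (algebraMap A B s * algebraMap A B t * algebraMap A B ((s : A) ^ q)) := by
          rw [hφ, map_mul, ← hx, map_mul, ← ha]; ring
      _ = _ := by rw [hsp]
  · intro a
    have := hf (algebraMap A B a) a 1 (by simp)
    simpa using this

end CartierMaps

/-! ### The two membership estimates at the origin. -/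

section Origin

variable {p : ℕ} {k : Type*} [Field k] {d : ℕ}

theorem mem_map_iterateFrobenius_idealOfVars {σ : Type*} [ExpChar k p] {e : ℕ}
    {g : MvPolynomial σ k} :
    g ∈ (idealOfVars σ k).map (iterateFrobenius (MvPolynomial σ k) p e) ↔
      ∀ m ∈ g.support, ∃ i, p ^ e ≤ m i := by
  have : (idealOfVars σ k).map (iterateFrobenius (MvPolynomial σ k) p e) =
      Ideal.span ((fun s => monomial s (1 : k)) '' Set.range fun i => Finsupp.single i (p ^ e)) := by
    rw [idealOfVars, Ideal.map_span, ← Set.range_comp, ← Set.range_comp]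
    congr 2
    ext1 i
    simp [iterateFrobenius_def, X_pow_eq_monomial]
  rw [this, mem_ideal_span_monomial_image]
  simp

theorem idealOfVars_primeCompl_le : (idealOfVars (Fin d) k).primeCompl ≤
    nonZeroDivisors (MvPolynomial (Fin d) k) :=
  (idealOfVars (Fin d) k).primeCompl_le_nonZeroDivisors

theorem algebraMap_originLocalRing_injective :
    Function.Injective (algebraMap (MvPolynomial (Fin d) k) (OriginLocalRing k d)) :=
  IsLocalization.injective _ idealOfVars_primeCompl_le

instance [ExpChar k p] : ExpChar (OriginLocalRing k d) p :=
  expChar_of_injective_ringHom (algebraMap_originLocalRing_injective (k := k) (d := d)) p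

theorem algebraMap_mem_maximalIdeal {g : MvPolynomial (Fin d) k} (hg : g ∈ idealOfVars (Fin d) k) :
    algebraMap _ (OriginLocalRing k d) g ∈ IsLocalRing.maximalIdeal (OriginLocalRing k d) :=
  (IsLocalization.AtPrime.to_map_mem_maximal_iff _ (idealOfVars (Fin d) k) g).mpr hg

theorem fptAtOrigin_le_div [ExpChar k p] (hp : 1 < p) {g : MvPolynomial (Fin d) k} {r e : ℕ}
    (hg : g ^ r ∈ (idealOfVars (Fin d) k).map (iterateFrobenius (MvPolynomial (Fin d) k) p e)) :
    fptAtOrigin p g ≤ r / (p : ℝ) ^ e := by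
  refine fpt_span_singleton_le_div hp
    (IsLocalRing.maximalIdeal.isMaximal (OriginLocalRing k d)).ne_top ?_
  rw [← map_pow]
  suffices h : Ideal.map (iterateFrobenius _ p e) (idealOfVars (Fin d) k) ≤ Ideal.comap
      (algebraMap _ (OriginLocalRing k d)) (Ideal.map (iterateFrobenius _ p e)
        (IsLocalRing.maximalIdeal (OriginLocalRing k d))) from h hg
  refine Ideal.map_le_iff_le_comap.mpr fun x hx => ?_
  rw [Ideal.mem_comap, Ideal.mem_comap, RingHom.map_iterateFrobenius]
  exact Ideal.mem_map_of_mem _ (algebraMap_mem_maximalIdeal hx)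

/-- The Cartier map selecting the exponents `μ + p ^ e n`, normalized at the coefficient of `x ^ μ`,
sends `g ^ r` to a polynomial with constant term `1`, a unit at the origin. -/
theorem div_le_fptAtOrigin [ExpChar k p] (hp : 1 < p) {g : MvPolynomial (Fin d) k}
    (hg : g ∈ idealOfVars (Fin d) k) {r e : ℕ} (hr : r ≠ 0) (he : 0 < e) {μ : Fin d →₀ ℕ}
    (hμ : coeff μ (g ^ r) ≠ 0) (hμq : ∀ i, μ i < p ^ e) :
    r / (p : ℝ) ^ e ≤ fptAtOrigin p g := by
  have hp0 : p ≠ 0 := by omega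
  obtain ⟨ψ, hψ, hψ1⟩ := exists_isCartierMap_apply_eq_one p e hμ
  obtain ⟨φ, hφ, hφc⟩ := hψ.exists_mvPolynomial hp0 hμq
  obtain ⟨φ', hφ', hφφ'⟩ := hφ.exists_localization (B := OriginLocalRing k d)
    (idealOfVars_primeCompl_le (k := k)) hp0
  have hu : IsUnit (φ' (algebraMap _ (OriginLocalRing k d) g ^ r)) := by
    rw [← map_pow, hφφ']
    refine IsLocalization.map_units (OriginLocalRing k d)
      (⟨_, ?_⟩ : (idealOfVars (Fin d) k).primeCompl)
    rw [Ideal.mem_primeCompl_iff, idealOfVars_eq_ker, RingHom.mem_ker, constantCoeff_eq, hφc]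
    simp [hψ1]
  refine le_trans ?_ (div_le_fpt_span_singleton hp
    (IsLocalRing.maximalIdeal.isMaximal (OriginLocalRing k d)).ne_top
    (algebraMap_mem_maximalIdeal hg) hr he hφ' hu)
  have hq1 : (0 : ℝ) < (p : ℝ) ^ e - 1 := by
    rw [sub_pos]; exact_mod_cast Nat.one_lt_pow he.ne' hp
  gcongr
  linarith

theorem fptAtOrigin_mem_principalThresholds {g : MvPolynomial (Fin d) k}
    (hg : g ∈ idealOfVars (Fin d) k) :
    fptAtOrigin p g ∈ principalThresholds p (OriginLocalRing k d) := by
  refine ⟨_, ?_, ⟨_, rfl⟩, rfl⟩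
  intro h
  have h1 := (Ideal.span_singleton_le_iff_mem _).mpr (algebraMap_mem_maximalIdeal hg)
  change Ideal.span _ = ⊤ at h
  rw [h] at h1
  exact (IsLocalRing.maximalIdeal.isMaximal (OriginLocalRing k d)).ne_top (top_le_iff.mp h1)

theorem fptAtOrigin_nonneg (g : MvPolynomial (Fin d) k) : 0 ≤ fptAtOrigin p g := by
  unfold fptAtOrigin fpt
  split_ifs
  · exact le_rfl
  · exact Real.sSup_nonneg fun s hs => hs.1

theorem monomial_mem_idealOfVars {σ : Type*} {m : σ →₀ ℕ} (hm : m ≠ 0) (c : k) :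
    monomial m c ∈ idealOfVars σ k := by
  obtain ⟨i, hi⟩ := Finsupp.ne_iff.mp hm
  rw [idealOfVars, ← Set.image_univ, mem_ideal_span_X_image]
  intro n hn
  have : n = m := by simpa using support_monomial_subset hn
  subst this
  exact ⟨i, Set.mem_univ i, hi⟩

end Origin

/-! ### Arithmetic of the truncations of `c`. -/

section Floor

/-- The integers `⌊c p ^ e⌋ + 1` cannot all be divisible by `p` from some point on. -/
theorem exists_not_dvd_floor_add_one {p : ℕ} (hp : 1 < p) {c : ℝ} (hc : 0 ≤ c) (E : ℕ) :
    ∃ e, E ≤ e ∧ ¬ p ∣ ⌊c * (p : ℝ) ^ e⌋₊ + 1 := by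
  by_contra! h
  have hp0 : (0 : ℝ) < p := by exact_mod_cast (by omega : 0 < p)
  -- Divisibility makes `(⌊c p ^ e⌋ + 1) / p ^ e` constant for `e ≥ E`. It always exceeds `c`, by at
  -- most `p ^ (-e)`, which is impossible for a constant.
  have step : ∀ j, ⌊c * (p : ℝ) ^ (E + j)⌋₊ + 1 = p ^ j * (⌊c * (p : ℝ) ^ E⌋₊ + 1) := by
    intro j
    induction j with
    | zero => simp
    | succ j ih =>
      rw [pow_succ, mul_right_comm, ← ih]
      obtain ⟨t, ht⟩ := h (E + (j + 1)) (by omega)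
      rw [ht, mul_comm p t]
      congr 1
      have hlt := Nat.lt_floor_add_one (c * (p : ℝ) ^ (E + (j + 1)))
      have hle : (⌊c * (p : ℝ) ^ (E + j)⌋₊ : ℝ) ≤ _ := Nat.floor_le (by positivity)
      have hlt' := Nat.lt_floor_add_one (c * (p : ℝ) ^ (E + j))
      have hle' : (⌊c * (p : ℝ) ^ (E + (j + 1))⌋₊ : ℝ) ≤ _ := Nat.floor_le (by positivity)
      have ht' : (⌊c * (p : ℝ) ^ (E + (j + 1))⌋₊ : ℝ) + 1 = p * t := by exact_mod_cast ht
      have hpow : c * (p : ℝ) ^ (E + (j + 1)) = p * (c * (p : ℝ) ^ (E + j)) := by ring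
      rw [ht', hpow] at hlt
      have h1 : c * (p : ℝ) ^ (E + j) < t := lt_of_mul_lt_mul_left hlt hp0.le
      apply le_antisymm
      · have h2 : (⌊c * (p : ℝ) ^ (E + (j + 1))⌋₊ : ℝ) <
            p * ((⌊c * (p : ℝ) ^ (E + j)⌋₊ : ℝ) + 1) := by
          refine hle'.trans_lt ?_
          rw [hpow]
          gcongr
        have h3 : ⌊c * (p : ℝ) ^ (E + (j + 1))⌋₊ < p * (⌊c * (p : ℝ) ^ (E + j)⌋₊ + 1) := by
          exact_mod_cast h2
        refine Nat.le_of_mul_le_mul_left (?_ : p * _ ≤ p * _) (by omega)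
        omega
      · have : (⌊c * (p : ℝ) ^ (E + j)⌋₊ : ℝ) < t := hle.trans_lt h1
        have h4 : ⌊c * (p : ℝ) ^ (E + j)⌋₊ < t := by exact_mod_cast this
        omega
  have hlt := Nat.lt_floor_add_one (c * (p : ℝ) ^ E)
  set ε := ((⌊c * (p : ℝ) ^ E⌋₊ : ℝ) + 1) - c * (p : ℝ) ^ E with hε
  have hε0 : 0 < ε := by linarith
  obtain ⟨j, hj⟩ := pow_unbounded_of_one_lt (1 / ε) (by exact_mod_cast hp : (1 : ℝ) < p)
  rw [div_lt_iff₀ hε0] at hj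
  have h5 : (⌊c * (p : ℝ) ^ (E + j)⌋₊ : ℝ) + 1 = p ^ j * (⌊c * (p : ℝ) ^ E⌋₊ + 1) := by
    exact_mod_cast step j
  have h6 : (⌊c * (p : ℝ) ^ (E + j)⌋₊ : ℝ) ≤ _ := Nat.floor_le (by positivity)
  rw [pow_add] at h6
  rw [pow_add] at h5
  rw [hε] at hj
  nlinarith

theorem natCast_div_pow_mem_adjoin_inv (p r e : ℕ) :
    (r : ℝ) / (p : ℝ) ^ e ∈ Algebra.adjoin ℤ {((p : ℝ))⁻¹} := by
  rw [div_eq_mul_inv, ← inv_pow]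
  have hinv : ((p : ℝ))⁻¹ ∈ Algebra.adjoin ℤ {((p : ℝ))⁻¹} :=
    Algebra.subset_adjoin (Set.mem_singleton _)
  exact mul_mem (natCast_mem _ r) (pow_mem hinv e)

end Floor

/-! ### Perturbing `f` by a monomial of large degree. -/

section Perturbation

variable {p : ℕ} {k : Type*} [Field k] {d : ℕ}

/-- The coefficient of `x ^ (μ + l)` in `(f + x ^ l) ^ (N + 1)`, for homogeneous `f` of degree
different from that of `x ^ l`, comes only from the binomial term `(N + 1) f ^ N x ^ l`. -/
theorem coeff_add_monomial_pow {σ : Type*} {w : σ → ℕ} {f : MvPolynomial σ k} {D : ℕ}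
    (hf : IsWeightedHomogeneous w f D) {l : σ →₀ ℕ} (hl : Finsupp.weight w l ≠ D) {N : ℕ}
    {μ : σ →₀ ℕ} (hμ : Finsupp.weight w μ = N * D) :
    coeff (μ + l) ((f + monomial l 1) ^ (N + 1)) = (N + 1) * coeff μ (f ^ N) := by
  rw [add_comm f, add_pow, coeff_sum, Finset.sum_eq_single 1]
  · rw [pow_one, Nat.add_sub_cancel, Nat.choose_one_right, mul_assoc, add_comm μ,
      coeff_monomial_mul, one_mul, mul_comm, ← C_eq_coe_nat, coeff_C_mul]
    push_cast
    rfl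
  · intro j hj hj1
    obtain ⟨i, hi⟩ : ∃ i, N + 1 = i + j := ⟨N + 1 - j, by
      have := Finset.mem_range.mp hj; omega⟩
    have hhom : IsWeightedHomogeneous w (monomial l (1 : k) ^ j * f ^ i)
        (j • Finsupp.weight w l + i • D) :=
      ((isWeightedHomogeneous_monomial w l 1 rfl).pow j).mul (hf.pow i)
    rw [hi, Nat.add_sub_cancel, ← C_eq_coe_nat, mul_comm, coeff_C_mul,
      hhom.coeff_eq_zero _ ?_, mul_zero]
    rw [map_add, hμ, smul_eq_mul, smul_eq_mul]
    intro heq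
    -- Trading a factor `f` for `x ^ l` changes the degree, so only `j = 1` reaches the degree of `x
    -- ^ (μ + l)`.
    have h1 : ((j : ℤ) - 1) * ((Finsupp.weight w l : ℤ) - D) = 0 := by
      zify at heq hi
      linear_combination (-1 : ℤ) * heq + (D : ℤ) * hi
    rcases mul_eq_zero.mp h1 with h | h <;> omega
  · intro h
    simp at h

theorem fptAtOrigin_lt_of_add_monomial [CharP k p] (hp : p.Prime) {f : MvPolynomial (Fin d) k}
    {a : Fin d → ℕ} (hf : f ∈ idealOfVars (Fin d) k) {D : ℕ} (hfD : IsWeightedHomogeneous a f D)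
    (hlt : fptAtOrigin p f < (∑ i, (a i : ℝ)) / (D : ℝ)) (hD : 0 < D)
    (hpf : fptAtOrigin p f ∉ Algebra.adjoin ℤ {((p : ℝ))⁻¹}) (B : ℕ) :
    ∃ l : Fin d →₀ ℕ, B ≤ Finsupp.weight a l ∧
      fptAtOrigin p f < fptAtOrigin p (f + monomial l 1) := by
  have := Fact.mk hp
  have hp0 : (0 : ℝ) < p := by exact_mod_cast hp.pos
  set c := fptAtOrigin p f with hc
  have hc0 : 0 ≤ c := fptAtOrigin_nonneg f
  have hD0 : (0 : ℝ) < D := by exact_mod_cast hD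
  set S := ∑ i, a i with hS
  have hgap : 0 < (S : ℝ) - c * D := by
    rw [lt_div_iff₀ hD0] at hlt
    rw [hS]; push_cast; linarith
  -- The weight of `l` will be at least `p ^ e (S - c D) - S`. The summand `D + 1` keeps it
  -- different from `D`, and `E + 1` below ensures `e > 0`.
  obtain ⟨E, hE⟩ := pow_unbounded_of_one_lt (((B + D + 1 + S : ℕ) : ℝ) / ((S : ℝ) - c * D))
    (by exact_mod_cast hp.one_lt : (1 : ℝ) < p)
  obtain ⟨e, hEe, hdvd⟩ := exists_not_dvd_floor_add_one hp.one_lt hc0 (E + 1)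
  set N := ⌊c * (p : ℝ) ^ e⌋₊ with hN
  have hpe : (0 : ℝ) < (p : ℝ) ^ e := by positivity
  have hNle : (N : ℝ) ≤ c * (p : ℝ) ^ e := Nat.floor_le (by positivity)
  have hmem : f ^ N ∉
      (idealOfVars (Fin d) k).map (iterateFrobenius (MvPolynomial (Fin d) k) p e) := by
    intro h
    have h1 := fptAtOrigin_le_div hp.one_lt h
    have h2 : (N : ℝ) / (p : ℝ) ^ e ≤ c := (div_le_iff₀ hpe).mpr hNle
    apply hpf
    rw [show c = N / (p : ℝ) ^ e from le_antisymm h1 h2]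
    exact natCast_div_pow_mem_adjoin_inv p N e
  rw [mem_map_iterateFrobenius_idealOfVars] at hmem
  push Not at hmem
  obtain ⟨μ, hμ, hμq⟩ := hmem
  rw [mem_support_iff] at hμ
  have hμw : Finsupp.weight a μ = N * D := (hfD.pow N) hμ
  let l : Fin d →₀ ℕ := Finsupp.equivFunOnFinite.symm fun i => p ^ e - 1 - μ i
  have hl : ∀ i, μ i + l i = p ^ e - 1 := fun i => by
    have := hμq i
    change μ i + (p ^ e - 1 - μ i) = _
    omega
  have hwl : Finsupp.weight a μ + Finsupp.weight a l = (p ^ e - 1) * S := by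
    rw [← map_add, Finsupp.weight_eq_sum, hS, Finset.mul_sum]
    refine Finset.sum_congr rfl fun i _ => ?_
    rw [Finsupp.add_apply, hl, smul_eq_mul]
  have hBl : B + D + 1 ≤ Finsupp.weight a l := by
    have h1 : (p : ℝ) ^ E ≤ (p : ℝ) ^ e :=
      pow_le_pow_right₀ (by exact_mod_cast hp.one_lt.le) (by omega)
    rw [div_lt_iff₀ hgap] at hE
    have h2 : ((p ^ e - 1 : ℕ) : ℝ) = (p : ℝ) ^ e - 1 := by
      rw [Nat.cast_sub (Nat.one_le_pow _ _ hp.pos)]; push_cast; rfl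
    have h3 : (N : ℝ) * D + (Finsupp.weight a l : ℕ) = ((p : ℝ) ^ e - 1) * S := by
      rw [hμw] at hwl
      rw [← h2]
      exact_mod_cast hwl
    push_cast at hE
    have h4 : (N : ℝ) * D ≤ c * (p : ℝ) ^ e * D := by gcongr
    have h5 := mul_le_mul_of_nonneg_right h1 hgap.le
    have h6 : ((B + D + 1 : ℕ) : ℝ) ≤ (Finsupp.weight a l : ℕ) := by
      push_cast
      linarith
    exact_mod_cast h6
  refine ⟨l, by omega, ?_⟩
  have hcoeff : coeff (μ + l) ((f + monomial l 1) ^ (N + 1)) ≠ 0 := by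
    rw [coeff_add_monomial_pow hfD (by omega) hμw]
    refine mul_ne_zero ?_ hμ
    intro h0
    exact hdvd ((CharP.cast_eq_zero_iff k p (N + 1)).mp (by exact_mod_cast h0))
  have hl0 : l ≠ 0 := by
    intro h
    rw [h, map_zero] at hBl
    omega
  refine lt_of_lt_of_le ?_ (div_le_fptAtOrigin hp.one_lt
    (Ideal.add_mem _ hf (monomial_mem_idealOfVars hl0 1)) (Nat.succ_ne_zero N) (by omega : 0 < e)
    hcoeff fun i => ?_)
  · rw [lt_div_iff₀ hpe]
    push_cast
    exact Nat.lt_floor_add_one _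
  · rw [Finsupp.add_apply, hl]
    have := Nat.one_le_pow e p hp.pos
    omega

/-- With `q > 1 / ε` and `N = ⌊c q⌋`, the lower bound forces `f ^ (N + 1) ∈ 𝔪^[q]`. Membership
depends only on `f` modulo `𝔪^[q]`, so the threshold of the perturbation is at most `(N + 1) / q ≤ c
+ ε`. -/
theorem exists_fptAtOrigin_add_monomial_le [CharP k p] (hp : p.Prime)
    {f : MvPolynomial (Fin d) k} (hf : f ∈ idealOfVars (Fin d) k) (a : Fin d → ℕ) {ε : ℝ}
    (hε : 0 < ε) : ∃ B, ∀ l : Fin d →₀ ℕ, B ≤ Finsupp.weight a l →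
      fptAtOrigin p (f + monomial l 1) ≤ fptAtOrigin p f + ε := by
  have := Fact.mk hp
  have hp0 : (0 : ℝ) < p := by exact_mod_cast hp.pos
  set c := fptAtOrigin p f with hc
  have hc0 : 0 ≤ c := fptAtOrigin_nonneg f
  obtain ⟨e, he⟩ := pow_unbounded_of_one_lt (1 / ε) (by exact_mod_cast hp.one_lt : (1 : ℝ) < p)
  have hpe : (0 : ℝ) < (p : ℝ) ^ (e + 1) := by positivity
  replace he : 1 / ε < (p : ℝ) ^ (e + 1) := he.trans
    (pow_lt_pow_right₀ (by exact_mod_cast hp.one_lt) (by omega))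
  rw [div_lt_iff₀ hε] at he
  set N := ⌊c * (p : ℝ) ^ (e + 1)⌋₊ with hN
  have hfN : f ^ (N + 1) ∈
      (idealOfVars (Fin d) k).map (iterateFrobenius (MvPolynomial (Fin d) k) p (e + 1)) := by
    rw [mem_map_iterateFrobenius_idealOfVars]
    by_contra! h
    obtain ⟨μ, hμ, hμq⟩ := h
    have h1 := div_le_fptAtOrigin hp.one_lt hf N.succ_ne_zero e.succ_pos (mem_support_iff.mp hμ) hμq
    rw [div_le_iff₀ hpe] at h1
    push_cast at h1
    exact (Nat.lt_floor_add_one (c * (p : ℝ) ^ (e + 1))).not_ge h1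
  -- Beyond this weight some exponent of `l` is at least `p ^ (e + 1)`.
  refine ⟨∑ i, p ^ (e + 1) * a i + 1, fun l hl => ?_⟩
  have hlmem : monomial l (1 : k) ∈
      (idealOfVars (Fin d) k).map (iterateFrobenius (MvPolynomial (Fin d) k) p (e + 1)) := by
    rw [mem_map_iterateFrobenius_idealOfVars]
    intro m hm
    have : m = l := by simpa using support_monomial_subset hm
    subst this
    by_contra! h
    rw [Finsupp.weight_eq_sum] at hl
    have : ∑ i, m i • a i ≤ ∑ i, p ^ (e + 1) * a i :=
      Finset.sum_le_sum fun i _ => Nat.mul_le_mul_right _ (h i).le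
    omega
  have hmem : (f + monomial l 1) ^ (N + 1) ∈
      (idealOfVars (Fin d) k).map (iterateFrobenius (MvPolynomial (Fin d) k) p (e + 1)) := by
    obtain ⟨y, hy⟩ := sub_dvd_pow_sub_pow (f + monomial l 1) f (N + 1)
    rw [add_sub_cancel_left] at hy
    rw [← sub_add_cancel ((f + monomial l 1) ^ (N + 1)) (f ^ (N + 1)), hy]
    exact Ideal.add_mem _ (Ideal.mul_mem_right _ _ hlmem) hfN
  refine (fptAtOrigin_le_div hp.one_lt hmem).trans ?_
  rw [div_le_iff₀ hpe]
  push_cast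
  have hNle : (N : ℝ) ≤ c * (p : ℝ) ^ (e + 1) := Nat.floor_le (by positivity)
  nlinarith

end Perturbation

end FPT

theorem proposition3p1 (p : ℕ) [Fact p.Prime] (k : Type*) [Field k] [CharP k p]
    (hk : FPT.IsFFinite p k) (d : ℕ) (a : Fin d → ℕ) (ha : ∀ i, 0 < a i)
    (f : MvPolynomial (Fin d) k) (hf : f ∈ MvPolynomial.idealOfVars (Fin d) k)
    (D : ℕ) (hD : 0 < D) (hfD : MvPolynomial.IsWeightedHomogeneous a f D)
    (hlt : FPT.fptAtOrigin p f < (∑ i, (a i : ℝ)) / (D : ℝ))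
    (hp : FPT.fptAtOrigin p f ∉ Algebra.adjoin ℤ {((p : ℝ))⁻¹}) :
    AccPt (FPT.fptAtOrigin p f)
        (𝓟 (FPT.principalThresholds p (FPT.OriginLocalRing k d))) ∧
      ∃ l : ℕ → (Fin d →₀ ℕ),
        Tendsto (fun n => Finsupp.weight a (l n)) atTop atTop ∧
        (∀ n, FPT.fptAtOrigin p f < FPT.fptAtOrigin p (f + MvPolynomial.monomial (l n) 1)) ∧
        Tendsto (fun n => FPT.fptAtOrigin p (f + MvPolynomial.monomial (l n) 1)) atTop
          (𝓝 (FPT.fptAtOrigin p f)) := by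
  have hprime : p.Prime := Fact.out
  -- The bound `n + 1` rather than `n` keeps `l n` nonzero, so that `f + x ^ (l n)` stays in `𝔪`.
  choose l hl hfl using fun n =>
    FPT.fptAtOrigin_lt_of_add_monomial hprime hf hfD hlt hD hp (n + 1)
  have hweight : Tendsto (fun n => Finsupp.weight a (l n)) atTop atTop :=
    tendsto_atTop_mono (fun n => (Nat.le_succ n).trans (hl n)) tendsto_id
  have hlim : Tendsto (fun n => FPT.fptAtOrigin p (f + monomial (l n) 1)) atTop
      (𝓝 (FPT.fptAtOrigin p f)) := by
    rw [tendsto_order]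
    refine ⟨fun b hb => .of_forall fun n => hb.trans (hfl n), fun b hb => ?_⟩
    obtain ⟨B, hB⟩ := FPT.exists_fptAtOrigin_add_monomial_le hprime hf a
      (half_pos (sub_pos.mpr hb))
    filter_upwards [hweight.eventually_ge_atTop B] with n hn
    linarith [hB (l n) hn]
  refine ⟨?_, l, hweight, hfl, hlim⟩
  rw [accPt_iff_frequently]
  refine hlim.frequently (Eventually.frequently (.of_forall fun n => ⟨(hfl n).ne', ?_⟩))
  refine FPT.fptAtOrigin_mem_principalThresholds
    (Ideal.add_mem _ hf (FPT.monomial_mem_idealOfVars ?_ 1))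
  intro h
  have := hl n
  rw [h, map_zero] at this
  omega
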